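/- Let $G$ be a totally disconnected, locally compact topological group and let $\alpha\colon G\to G$ be an automorphism of topological groups. Let $U_\alpha:=\{x\in G:\lim_{n\to\infty}\alpha^n(x)=1\}$ be the contraction group of $\alpha$, let $U_{\alpha^{-1}}$ be that of $\alpha^{-1}$, and let $M_\alpha:=\{x\in G:\{\alpha^n(x):n\in\mathbb Z\}\text{ is relatively compact in }G\}$, which is a subgroup with $\alpha(M_\alpha)=M_\alpha$. For an automorphism $\beta$ of a topological group $H$, a compact open subgroup $V\subseteq H$ is called tidy for $\beta$ if, with $V_+:=\bigcap_{n\ge 0}\beta^n(V)$ and $V_-:=\bigcap_{n\ge 0}\beta^{-n}(V)$, one has $V=V_+V_-$, and both $\bigcup_{n\ge 0}\beta^n(V_+)$ and $\bigcup_{n\ge 0}\beta^{-n}(V_-)$ are closed in $H$. The automorphism $\beta$ is called tidy if every identity neighbourhood of $H$ contains a subgroup tidy for $\beta$. Suppose that $\alpha|_{M_\alpha}$ is tidy, where $M_\alpha$ carries the subspace topology. Then $$K=U_0=\{1\},$$ where $U_0:=\overline{U_\alpha}\cap\overline{U_{\alpha^{-1}}}$ and $$K:=\bigcap_{O}\overline{\{x\in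 M_\alpha:\alpha^n(x)\in O\text{ for all sufficiently large }n\}},$$ the intersection being over all compact open subgroups $O$ of $G$ and the closures being taken in $G$. -/

import Mathlib

open Filter Topology
open scoped Pointwise

/-- The automorphism `α ^ n` for an integer `n`. -/
def autPow {G : Type*} [Group G] [TopologicalSpace G] (α : G ≃ₜ* G) (n : ℤ) : G ≃* G :=
  ((α.toMulEquiv : MulAut G) ^ n : MulAut G)

theorem autPow_zero {G : Type*} [Group G] [TopologicalSpace G] (α : G ≃ₜ* G) (x : G) :
    autPow α 0 x = x := by
  simp [autPow]

theorem autPow_add_one {G : Type*} [Group G] [TopologicalSpace G] (α : G ≃ₜ* G) (n : ℤ) (x : G) :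
    autPow α (n + 1) x = autPow α n (α x) := by
  have h : ((α.toMulEquiv : MulAut G) ^ (n + 1) : MulAut G)
      = (α.toMulEquiv : MulAut G) ^ n * (α.toMulEquiv : MulAut G) := zpow_add_one _ _
  exact DFunLike.congr_fun h x

/-- The subgroup `V₊ = ⋂_{n ≥ 0} α ^ n (V)`. -/
def plusPart {G : Type*} [Group G] [TopologicalSpace G] (α : G ≃ₜ* G) (V : Subgroup G) :
    Subgroup G :=
  ⨅ n : ℕ, V.map (autPow α (n : ℤ)).toMonoidHom

/-- The subgroup `V₋ = ⋂_{n ≥ 0} α ^ (-n) (V)`. -/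
def minusPart {G : Type*} [Group G] [TopologicalSpace G] (α : G ≃ₜ* G) (V : Subgroup G) :
    Subgroup G :=
  ⨅ n : ℕ, V.map (autPow α (-(n : ℤ))).toMonoidHom

/-- `V₊₊ = ⋃_{n ≥ 0} α ^ n (V₊)`. -/
def plusPlus {G : Type*} [Group G] [TopologicalSpace G] (α : G ≃ₜ* G) (V : Subgroup G) : Set G :=
  ⋃ n : ℕ, autPow α (n : ℤ) '' (plusPart α V : Set G)

/-- `V₋₋ = ⋃_{n ≥ 0} α ^ (-n) (V₋)`. -/
def minusMinus {G : Type*} [Group G] [TopologicalSpace G] (α : G ≃ₜ* G) (V : Subgroup G) : Set G :=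
  ⋃ n : ℕ, autPow α (-(n : ℤ)) '' (minusPart α V : Set G)

/-- `V` is a compact open subgroup which is tidy for `α`. -/
structure IsTidySubgroup {G : Type*} [Group G] [TopologicalSpace G] (α : G ≃ₜ* G)
    (V : Subgroup G) : Prop where
  isOpen : IsOpen (V : Set G)
  isCompact : IsCompact (V : Set G)
  T1 : (V : Set G) = (plusPart α V : Set G) * (minusPart α V : Set G)
  T2_plus : IsClosed (plusPlus α V)
  T2_minus : IsClosed (minusMinus α V)

/-- `α` is tidy: every identity neighbourhood contains a subgroup tidy for `α`. -/
def IsTidyAut {G : Type*} [Group G] [TopologicalSpace G] (α : G ≃ₜ* G) : Prop :=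
  ∀ U ∈ 𝓝 (1 : G), ∃ V : Subgroup G, IsTidySubgroup α V ∧ (V : Set G) ⊆ U

/-- The contraction group `U_α` of all `x` with `α ^ n (x) → 1` as `n → ∞`. -/
def contractionGroup {G : Type*} [Group G] [TopologicalSpace G] [IsTopologicalGroup G]
    (α : G ≃ₜ* G) : Subgroup G where
  carrier := {x | Tendsto (fun n : ℕ => autPow α (n : ℤ) x) atTop (𝓝 1)}
  one_mem' := by
    simp only [Set.mem_ofPred_eq, map_one]
    exact tendsto_const_nhds
  mul_mem' := by
    intro a b ha hb
    simpa using Tendsto.mul ha hb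
  inv_mem' := by
    intro a ha
    simpa using Tendsto.inv ha

/-- The Levi factor `M_α` of all `x` whose orbit `α ^ ℤ (x)` is relatively compact. -/
def leviFactor {G : Type*} [Group G] [TopologicalSpace G] [IsTopologicalGroup G]
    (α : G ≃ₜ* G) : Subgroup G where
  carrier := {x | IsCompact (closure (Set.range fun n : ℤ => autPow α n x))}
  one_mem' := by
    have h : (Set.range fun n : ℤ => autPow α n (1 : G)) = {1} := by
      simp
    show IsCompact (closure (Set.range fun n : ℤ => autPow α n (1 : G)))
    rw [h]
    exact isCompact_singleton.closure
  mul_mem' := by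
    intro a b ha hb
    refine (IsCompact.mul ha hb).closure_of_subset ?_
    rintro _ ⟨n, rfl⟩
    exact ⟨_, subset_closure ⟨n, rfl⟩, _, subset_closure ⟨n, rfl⟩, (map_mul _ _ _).symm⟩
  inv_mem' := by
    intro a ha
    refine (IsCompact.inv ha).closure_of_subset ?_
    rintro _ ⟨n, rfl⟩
    rw [Set.mem_inv]
    refine subset_closure ⟨n, ?_⟩
    simp

theorem apply_mem_leviFactor_iff {G : Type*} [Group G] [TopologicalSpace G] [IsTopologicalGroup G]
    (α : G ≃ₜ* G) (x : G) : α x ∈ leviFactor α ↔ x ∈ leviFactor α := by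
  have h : (Set.range fun n : ℤ => autPow α n (α x)) = Set.range fun n : ℤ => autPow α n x := by
    ext y
    constructor
    · rintro ⟨n, rfl⟩
      exact ⟨n + 1, autPow_add_one α n x⟩
    · rintro ⟨n, rfl⟩
      refine ⟨n - 1, ?_⟩
      have := autPow_add_one α (n - 1) x
      rw [sub_add_cancel] at this
      exact this.symm
  show IsCompact (closure (Set.range fun n : ℤ => autPow α n (α x))) ↔
    IsCompact (closure (Set.range fun n : ℤ => autPow α n x))
  rw [h]

/-- The restriction of `α` to an `α`-stable subgroup `H`, equipped with the subspace topology. -/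
def restrictAut {G : Type*} [Group G] [TopologicalSpace G] (α : G ≃ₜ* G) (H : Subgroup G)
    (hH : ∀ x, α x ∈ H ↔ x ∈ H) : H ≃ₜ* H where
  toFun x := ⟨α x, (hH x).2 x.2⟩
  invFun x := ⟨α.symm x, (hH _).1 (by simp)⟩
  left_inv x := Subtype.ext (α.symm_apply_apply x)
  right_inv x := Subtype.ext (α.apply_symm_apply x)
  map_mul' x y := Subtype.ext (map_mul α (x : G) (y : G))
  continuous_toFun := (α.continuous_toFun.comp continuous_subtype_val).subtype_mk _
  continuous_invFun := (α.continuous_invFun.comp continuous_subtype_val).subtype_mk _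

/-- The restriction of `α` to its Levi factor. -/
def leviRestrict {G : Type*} [Group G] [TopologicalSpace G] [IsTopologicalGroup G]
    (α : G ≃ₜ* G) : leviFactor α ≃ₜ* leviFactor α :=
  restrictAut α (leviFactor α) (apply_mem_leviFactor_iff α)

/-- The subgroup of all `x ∈ M_α` such that `α ^ n (x) ∈ O` for all sufficiently large `n`. -/
def eventualSubgroup {G : Type*} [Group G] [TopologicalSpace G] [IsTopologicalGroup G]
    (α : G ≃ₜ* G) (O : Subgroup G) : Subgroup G where
  carrier := {x | x ∈ leviFactor α ∧ ∀ᶠ n : ℕ in atTop, autPow α (n : ℤ) x ∈ O}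
  one_mem' := ⟨one_mem _, by simp [one_mem]⟩
  mul_mem' := by
    rintro a b ⟨ha, ha'⟩ ⟨hb, hb'⟩
    refine ⟨mul_mem ha hb, ?_⟩
    filter_upwards [ha', hb'] with n h1 h2
    rw [map_mul]
    exact mul_mem h1 h2
  inv_mem' := by
    rintro a ⟨ha, ha'⟩
    refine ⟨inv_mem ha, ?_⟩
    filter_upwards [ha'] with n h1
    rw [map_inv]
    exact inv_mem h1

/-- The subgroup `K`: the intersection, over all compact open subgroups `O` of `G`, of the closures
in `G` of the subgroups `eventualSubgroup α O`. -/
def tidyingK {G : Type*} [Group G] [TopologicalSpace G] [IsTopologicalGroup G]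
    (α : G ≃ₜ* G) : Subgroup G :=
  ⨅ (O : Subgroup G) (_ : IsCompact (O : Set G)) (_ : IsOpen (O : Set G)),
    (eventualSubgroup α O).topologicalClosure

/-- The subgroup `U₀`: the intersection of the closures of `U_α` and `U_{α⁻¹}`. -/
def contractionU0 {G : Type*} [Group G] [TopologicalSpace G] [IsTopologicalGroup G]
    (α : G ≃ₜ* G) : Subgroup G :=
  (contractionGroup α).topologicalClosure ⊓ (contractionGroup α.symm).topologicalClosure

/-! On `M = leviFactor α` all orbits are bounded, and this forces a tidy subgroup to be
`α`-invariant (`IsTidySubgroup.autPow_mem`, by a Baire argument on the closed subgroup `V₋₋`). Hence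
there are compact open `O` in `G` with `O ∩ M` invariant, closed and as small as desired
(`exists_subgroup_inter_leviFactor`). Points of `M` whose orbit enters `O` then lie in `O ∩ M`
already, which gives `K = 1`.

For `U₀`, replace `O` by `V = ⋂_{0 ≤ k ≤ N} α ^ k (O)` with `V = V₊ V₋`. Invariance of `V ∩ M` makes
the group of points eventually in `V` closed (`isClosed_eventuallyIn`), so it contains the closure
of `U_α`; likewise for `α⁻¹`. A point of `U₀` thus has an orbit that is in `V` at almost all times:
it lies in `M`, and by invariance in the small set `O ∩ M`. -/

section AutPow

/-! ### Powers of an automorphism and the sets they define. -/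

variable {G : Type*} [Group G] [TopologicalSpace G]

theorem autPow_add (α : G ≃ₜ* G) (m n : ℤ) (x : G) :
    autPow α (m + n) x = autPow α m (autPow α n x) := by
  have h : ((α.toMulEquiv : MulAut G) ^ (m + n) : MulAut G)
      = (α.toMulEquiv : MulAut G) ^ m * (α.toMulEquiv : MulAut G) ^ n := zpow_add _ _ _
  exact DFunLike.congr_fun h x

theorem autPow_symm (α : G ≃ₜ* G) (n : ℤ) (x : G) : autPow α.symm n x = autPow α (-n) x := by
  have h1 : (α.symm.toMulEquiv : MulAut G) = (α.toMulEquiv : MulAut G)⁻¹ := rfl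
  have h : ((α.symm.toMulEquiv : MulAut G) ^ n : MulAut G)
      = (α.toMulEquiv : MulAut G) ^ (-n) := by rw [h1, inv_zpow, zpow_neg]
  exact DFunLike.congr_fun h x

theorem autPow_neg_autPow (α : G ≃ₜ* G) (n : ℤ) (x : G) :
    autPow α (-n) (autPow α n x) = x := by
  rw [← autPow_add, neg_add_cancel, autPow_zero]

theorem autPow_autPow_neg (α : G ≃ₜ* G) (n : ℤ) (x : G) :
    autPow α n (autPow α (-n) x) = x := by
  rw [← autPow_add, add_neg_cancel, autPow_zero]

theorem continuous_autPow_nat (α : G ≃ₜ* G) (n : ℕ) : Continuous (autPow α (n : ℤ)) := by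
  induction n with
  | zero => exact
      (continuous_id : Continuous (id : G → G)).congr fun x => (autPow_zero α x).symm
  | succ k ih =>
    refine (ih.comp α.continuous_toFun).congr fun x => ?_
    push_cast
    exact (autPow_add_one α k x).symm

theorem continuous_autPow (α : G ≃ₜ* G) (n : ℤ) : Continuous (autPow α n) := by
  obtain ⟨k, rfl | rfl⟩ := n.eq_nat_or_neg
  · exact continuous_autPow_nat α k
  · exact (continuous_autPow_nat α.symm k).congr fun x => autPow_symm α k x

theorem mem_map_autPow (α : G ≃ₜ* G) (V : Subgroup G) (n : ℤ) (x : G) :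
    x ∈ V.map (autPow α n).toMonoidHom ↔ autPow α (-n) x ∈ V := by
  constructor
  · rintro ⟨y, hy, rfl⟩
    simpa [autPow_neg_autPow] using hy
  · intro h
    exact ⟨_, h, autPow_autPow_neg α n x⟩

theorem mem_minusPart (α : G ≃ₜ* G) (V : Subgroup G) (x : G) :
    x ∈ minusPart α V ↔ ∀ n : ℕ, autPow α n x ∈ V := by
  simp only [minusPart, Subgroup.mem_iInf, mem_map_autPow, neg_neg]

theorem plusPart_eq (α : G ≃ₜ* G) (V : Subgroup G) : plusPart α V = minusPart α.symm V := by
  ext x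
  simp only [plusPart, mem_minusPart, Subgroup.mem_iInf, mem_map_autPow, autPow_symm]

theorem plusPlus_eq (α : G ≃ₜ* G) (V : Subgroup G) : plusPlus α V = minusMinus α.symm V := by
  ext x
  simp only [plusPlus, minusMinus, plusPart_eq, autPow_symm, neg_neg]

theorem mem_minusMinus (α : G ≃ₜ* G) (V : Subgroup G) (x : G) :
    x ∈ minusMinus α V ↔ ∀ᶠ n : ℕ in atTop, autPow α n x ∈ V := by
  simp only [minusMinus, Set.mem_iUnion, eventually_atTop]
  refine exists_congr fun n => ?_
  constructor
  · rintro ⟨y, hy, rfl⟩ m hm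
    have := (mem_minusPart α V y).1 hy (m - n)
    rw [← autPow_add]
    convert this using 2
    push_cast [hm]
    ring_nf
  · intro h
    refine ⟨autPow α n x, (mem_minusPart α V _).2 fun m => ?_, autPow_neg_autPow α n x⟩
    have := h (m + n) (by omega)
    rw [← autPow_add]
    exact_mod_cast this

/-- The subgroup of all `x` such that `α ^ n (x) ∈ V` for all sufficiently large `n`. -/
def eventuallyIn (α : G ≃ₜ* G) (V : Subgroup G) : Subgroup G where
  carrier := {x | ∀ᶠ n : ℕ in atTop, autPow α n x ∈ V}
  one_mem' := by simp [one_mem]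
  mul_mem' := by
    intro a b ha hb
    filter_upwards [ha, hb] with n h1 h2
    rw [map_mul]
    exact mul_mem h1 h2
  inv_mem' := by
    intro a ha
    filter_upwards [ha] with n h1
    rw [map_inv]
    exact inv_mem h1

theorem mem_eventuallyIn (α : G ≃ₜ* G) (V : Subgroup G) (x : G) :
    x ∈ eventuallyIn α V ↔ ∀ᶠ n : ℕ in atTop, autPow α n x ∈ V := Iff.rfl

theorem coe_eventuallyIn (α : G ≃ₜ* G) (V : Subgroup G) :
    (eventuallyIn α V : Set G) = minusMinus α V :=
  Set.ext fun x => (mem_minusMinus α V x).symm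

theorem autPow_mem_eventuallyIn {α : G ≃ₜ* G} {V : Subgroup G} {x : G}
    (hx : x ∈ eventuallyIn α V) (k : ℤ) : autPow α k x ∈ eventuallyIn α V := by
  rw [mem_eventuallyIn, eventually_atTop] at hx ⊢
  obtain ⟨N, hN⟩ := hx
  refine ⟨N + k.natAbs, fun n hn => ?_⟩
  obtain ⟨m, hm⟩ : ∃ m : ℕ, (m : ℤ) = n + k := ⟨(n + k).toNat, by omega⟩
  rw [← autPow_add, ← hm]
  exact hN m (by omega)

theorem isClosed_setOf_forall_autPow_mem (α : G ≃ₜ* G) {V : Subgroup G} (hV : IsClosed (V : Set G)) :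
    IsClosed {x : G | ∀ n : ℕ, autPow α n x ∈ V} := by
  have : {x : G | ∀ n : ℕ, autPow α n x ∈ V} = ⋂ n : ℕ, autPow α n ⁻¹' (V : Set G) := by
    ext; simp
  rw [this]
  exact isClosed_iInter fun n => hV.preimage (continuous_autPow α n)

/-- The subgroup `⋂_{0 ≤ k ≤ N} α ^ k (O)`. -/
def iteratedInter (α : G ≃ₜ* G) (O : Subgroup G) (N : ℕ) : Subgroup G :=
  ⨅ k : Fin (N + 1), O.comap (autPow α (-((k : ℕ) : ℤ))).toMonoidHom

theorem mem_iteratedInter {α : G ≃ₜ* G} {O : Subgroup G} {N : ℕ} {x : G} :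
    x ∈ iteratedInter α O N ↔ ∀ k : ℕ, k ≤ N → autPow α (-(k : ℤ)) x ∈ O := by
  simp only [iteratedInter, Subgroup.mem_iInf]
  exact ⟨fun h k hk => h ⟨k, by omega⟩, fun h k => h k (by omega)⟩

theorem coe_iteratedInter (α : G ≃ₜ* G) (O : Subgroup G) (N : ℕ) :
    (iteratedInter α O N : Set G) =
      ⋂ k : Fin (N + 1), autPow α (-((k : ℕ) : ℤ)) ⁻¹' (O : Set G) := by
  simp [iteratedInter]

theorem isOpen_iteratedInter (α : G ≃ₜ* G) {O : Subgroup G} (hO : IsOpen (O : Set G)) (N : ℕ) :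
    IsOpen (iteratedInter α O N : Set G) := by
  rw [coe_iteratedInter]
  exact isOpen_iInter_of_finite fun k => hO.preimage (continuous_autPow α _)

theorem iteratedInter_le (α : G ≃ₜ* G) (O : Subgroup G) (N : ℕ) : iteratedInter α O N ≤ O :=
  fun x hx => by simpa [autPow_zero] using mem_iteratedInter.1 hx 0 (by omega)

end AutPow

/-! ### Closed subgroups and compact open subgroups. -/

section TopologicalGroup

variable {G : Type*} [Group G] [TopologicalSpace G] [IsTopologicalGroup G]

/-- A subgroup which is closed near the identity is closed. -/
theorem isClosed_of_inter_subset (H : Subgroup G) {N C : Set G} (hN : IsOpen N)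
    (h1 : (1 : G) ∈ N) (hC : IsClosed C) (hNC : (H : Set G) ∩ N ⊆ C) (hCH : C ⊆ H) :
    IsClosed (H : Set G) := by
  rw [← closure_subset_iff_isClosed]
  intro x hx
  have hc : Continuous fun y : G => y⁻¹ * x := by fun_prop
  have hnh : (fun y : G => y⁻¹ * x) ⁻¹' N ∈ 𝓝 x :=
    (hN.preimage hc).mem_nhds (by simpa using h1)
  obtain ⟨y, hyN, hyH⟩ := mem_closure_iff_nhds.1 hx _ hnh
  -- Translating by a nearby `y ∈ H` moves the limit point `x` into `N`, where `H` is controlled by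
  -- `C`.
  have hyx : y⁻¹ * x ∈ H.topologicalClosure :=
    mul_mem (inv_mem (H.le_topologicalClosure hyH)) hx
  have : y⁻¹ * x ∈ C := by
    have h2 : y⁻¹ * x ∈ closure ((H : Set G) ∩ N) :=
      hN.closure_inter ⟨hyx, hyN⟩
    exact closure_minimal hNC hC h2
  have := mul_mem (show y ∈ H from hyH) (hCH this)
  simpa using this

/-- In a totally disconnected, locally compact group, every neighbourhood of a compact subgroup
contains a compact open subgroup which contains the compact subgroup. -/
theorem exists_compact_open_subgroup [LocallyCompactSpace G] [TotallyDisconnectedSpace G]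
    {W : Subgroup G} (hW : IsCompact (W : Set G)) {A : Set G} (hA : IsOpen A)
    (hWA : (W : Set G) ⊆ A) :
    ∃ O : Subgroup G, IsOpen (O : Set G) ∧ IsCompact (O : Set G) ∧ W ≤ O ∧ (O : Set G) ⊆ A := by
  obtain ⟨V, hV, hWV⟩ := compact_open_separated_mul_right hW hA hWA
  obtain ⟨Q, hQ, hQ1⟩ := exists_compact_mem_nhds (1 : G)
  obtain ⟨T, hT, h1T, hTs⟩ := loc_compact_Haus_tot_disc_of_zero_dim.mem_nhds_iff.1
    (inter_mem hV hQ1)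
  have hTc : IsCompact T := hQ.of_isClosed_subset hT.1 (hTs.trans Set.inter_subset_right)
  -- `C` is compact open and stable under left translation by `W`. Its stabilizer therefore contains
  -- `W`, and it lies in `C` because `1 ∈ C`.
  set C : Set G := (W : Set G) * T
  have hCc : IsCompact C := hW.mul hTc
  have hCo : IsOpen C := hT.2.mul_left
  have h1C : (1 : G) ∈ C := ⟨1, one_mem W, 1, h1T, one_mul 1⟩
  have hOC : ((MulAction.stabilizer G C : Subgroup G) : Set G) ⊆ C := by
    intro g hg
    have hg : g • C = C := hg
    rw [← hg]
    exact ⟨1, h1C, mul_one g⟩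
  have hOo : IsOpen ((MulAction.stabilizer G C : Subgroup G) : Set G) := by
    obtain ⟨S, hS, hSC⟩ := compact_open_separated_mul_left hCc hCo subset_rfl
    have key : ∀ s ∈ S, s • C ⊆ C := by
      rintro s hs _ ⟨c, hc, rfl⟩
      exact hSC ⟨s, hs, c, hc, rfl⟩
    refine Subgroup.isOpen_of_mem_nhds _ (g := 1) ?_
    filter_upwards [hS, inv_mem_nhds_one G hS] with s hs hs'
    refine (key s hs).antisymm ?_
    rw [Set.subset_smul_set_iff]
    exact key _ hs'
  refine ⟨MulAction.stabilizer G C, hOo, hCc.of_isClosed_subset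
    (Subgroup.isClosed_of_isOpen _ hOo) hOC, fun w hw => ?_, hOC.trans ?_⟩
  · have : ∀ v ∈ W, v • C ⊆ C := by
      rintro v hv _ ⟨_, ⟨x, hx, t, ht, rfl⟩, rfl⟩
      exact ⟨v * x, mul_mem hv hx, t, ht, mul_assoc _ _ _⟩
    refine (this w hw).antisymm ?_
    rw [Set.subset_smul_set_iff]
    exact this _ (inv_mem hw)
  · exact (Set.mul_subset_mul_left (hTs.trans Set.inter_subset_left)).trans hWV

/-! ### Tidy subgroups and bounded orbits. -/

/-- If `V₋₋` is closed, then bounded orbits starting in `V₋` never leave `V`. -/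
theorem autPow_mem_of_isClosed_minusMinus [T2Space G] [LocallyCompactSpace G] (α : G ≃ₜ* G)
    {V : Subgroup G} (hV : IsClosed (V : Set G)) (hS : IsClosed (minusMinus α V)) {x : G}
    (hx : IsCompact (closure (Set.range fun n : ℤ => autPow α n x)))
    (hxV : ∀ n : ℕ, autPow α n x ∈ V) (k : ℤ) : autPow α k x ∈ V := by
  rw [← coe_eventuallyIn] at hS
  set S := eventuallyIn α V
  have : LocallyCompactSpace S := hS.isClosedEmbedding_subtypeVal.locallyCompactSpace
  -- `F n` consists of the points that are in `V` from time `n` on.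
  let F : ℕ → Subgroup S := fun n =>
    ⨅ m : ℕ, V.comap ((autPow α ((n + m : ℕ) : ℤ)).toMonoidHom.comp S.subtype)
  have memF : ∀ n (s : S), s ∈ F n ↔ ∀ m : ℕ, autPow α ((n + m : ℕ) : ℤ) (s : G) ∈ V := by
    intro n s
    simp [F, Subgroup.mem_iInf]
  have mono : Monotone F := by
    intro a b hab s hs
    rw [memF] at hs ⊢
    intro m
    have := hs (b - a + m)
    rwa [show a + (b - a + m) = b + m by omega] at this
  have closedF : ∀ n, IsClosed (F n : Set S) := by
    intro n
    have : (F n : Set S) =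
        ⋂ m : ℕ, (fun s : S => autPow α ((n + m : ℕ) : ℤ) (s : G)) ⁻¹' (V : Set G) := by
      ext s; simp [memF]
    rw [this]
    exact isClosed_iInter fun m =>
      hV.preimage ((continuous_autPow α _).comp continuous_subtype_val)
  have cover : ⋃ n, (F n : Set S) = Set.univ := by
    refine Set.eq_univ_of_forall fun s => ?_
    obtain ⟨N, hN⟩ := eventually_atTop.1 s.2
    exact Set.mem_iUnion.2 ⟨N, (memF N s).2 fun m => hN _ (by omega)⟩
  -- By Baire some `F n` has interior, so it and all later ones are open. Compactness then puts the
  -- whole orbit closure in a single one.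
  obtain ⟨n, s, hs⟩ := nonempty_interior_of_iUnion_of_closed closedF cover
  have openF : ∀ m, IsOpen (F (n + m) : Set S) := fun m =>
    Subgroup.isOpen_of_mem_nhds _ (g := s)
      (mem_of_superset (mem_interior_iff_mem_nhds.1 hs) (mono (by omega)))
  have hxS : x ∈ S := Eventually.of_forall hxV
  have orbitS : closure (Set.range fun n : ℤ => autPow α n x) ⊆ S := by
    refine closure_minimal ?_ hS
    rintro _ ⟨j, rfl⟩
    exact autPow_mem_eventuallyIn hxS j
  have hcpt : IsCompact ((↑) ⁻¹' closure (Set.range fun n : ℤ => autPow α n x) : Set S) :=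
    hS.isClosedEmbedding_subtypeVal.isCompact_preimage hx
  obtain ⟨m, hm⟩ := hcpt.elim_directed_cover (fun m => (F (n + m) : Set S)) openF
    (fun s _ => by
      obtain ⟨N, hN⟩ := Set.mem_iUnion.1 (cover.symm ▸ Set.mem_univ s : s ∈ ⋃ n, (F n : Set S))
      exact Set.mem_iUnion.2 ⟨N, mono (by omega) hN⟩)
    (directed_of_isDirected_le fun a b hab => mono (by omega))
  -- The waiting time `n + m` is uniform along the orbit, so starting that much earlier gives
  -- membership at time `k`.
  have hmem : (⟨autPow α (k - (n + m : ℕ)) x, autPow_mem_eventuallyIn hxS _⟩ : S) ∈ F (n + m) :=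
    hm (subset_closure ⟨_, rfl⟩)
  have := (memF _ _).1 hmem 0
  rw [← autPow_add] at this
  convert this using 2
  push_cast
  ring_nf

/-- If all orbits are bounded, then tidy subgroups are invariant. -/
theorem IsTidySubgroup.autPow_mem [T2Space G] [LocallyCompactSpace G] {α : G ≃ₜ* G}
    {V : Subgroup G} (hV : IsTidySubgroup α V)
    (hα : ∀ x, IsCompact (closure (Set.range fun n : ℤ => autPow α n x)))
    {x : G} (hx : x ∈ V) (k : ℤ) : autPow α k x ∈ V := by
  have hc : IsClosed (V : Set G) := hV.isCompact.isClosed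
  obtain ⟨a, ha, b, hb, rfl⟩ : x ∈ (plusPart α V : Set G) * (minusPart α V : Set G) :=
    hV.T1 ▸ hx
  have hb' := autPow_mem_of_isClosed_minusMinus α hc hV.T2_minus (hα b)
    ((mem_minusPart α V b).1 hb) k
  have hrange : (Set.range fun n : ℤ =>
      autPow α.symm n a) = Set.range fun n : ℤ => autPow α n a := by
    simp only [autPow_symm]
    exact (Equiv.neg ℤ).surjective.range_comp fun n : ℤ => autPow α n a
  have ha' := autPow_mem_of_isClosed_minusMinus α.symm hc (plusPlus_eq α V ▸ hV.T2_plus)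
    (hrange ▸ hα a) ((mem_minusPart α.symm V a).1 (plusPart_eq α V ▸ ha)) (-k)
  rw [autPow_symm, neg_neg] at ha'
  simpa only [map_mul] using mul_mem ha' hb'

/-! ### The Levi factor and its small invariant subgroups. -/

theorem mem_leviFactor (α : G ≃ₜ* G) (x : G) :
    x ∈ leviFactor α ↔ IsCompact (closure (Set.range fun n : ℤ => autPow α n x)) := Iff.rfl

theorem mem_leviFactor_symm (α : G ≃ₜ* G) (x : G) :
    x ∈ leviFactor α.symm ↔ x ∈ leviFactor α := by
  have hrange : (Set.range fun n : ℤ =>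
      autPow α.symm n x) = Set.range fun n : ℤ => autPow α n x := by
    simp only [autPow_symm]
    exact (Equiv.neg ℤ).surjective.range_comp fun n : ℤ => autPow α n x
  rw [mem_leviFactor, mem_leviFactor, hrange]

theorem autPow_mem_leviFactor {α : G ≃ₜ* G} {x : G} (hx : x ∈ leviFactor α) (k : ℤ) :
    autPow α k x ∈ leviFactor α := by
  refine (mem_leviFactor α _).2 (IsCompact.closure_of_subset hx ?_)
  rintro _ ⟨n, rfl⟩
  exact subset_closure ⟨n + k, autPow_add α n k x⟩

/-- An orbit which is in a compact set at almost all times is bounded. -/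
theorem mem_leviFactor_of_eventually [T2Space G] {α : G ≃ₜ* G} {V : Set G} (hV : IsCompact V)
    {x : G} (h1 : ∀ᶠ n : ℕ in atTop, autPow α n x ∈ V)
    (h2 : ∀ᶠ n : ℕ in atTop, autPow α (-(n : ℤ)) x ∈ V) : x ∈ leviFactor α := by
  obtain ⟨N, hN⟩ := eventually_atTop.1 (h1.and h2)
  have hfin : ((fun n : ℤ => autPow α n x) '' Set.Icc (-(N : ℤ)) N).Finite :=
    (Set.finite_Icc _ _).image _
  refine (mem_leviFactor α x).2 ((hV.union hfin.isCompact).closure_of_subset ?_)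
  rintro _ ⟨n, rfl⟩
  by_cases hn : n ∈ Set.Icc (-(N : ℤ)) N
  · exact Or.inr ⟨n, hn, rfl⟩
  · left
    obtain ⟨k, rfl | rfl⟩ := n.eq_nat_or_neg
    · exact (hN k (by simp at hn; omega)).1
    · exact (hN k (by simp at hn; omega)).2

theorem coe_autPow_leviRestrict (α : G ≃ₜ* G) (n : ℤ) (x : leviFactor α) :
    (autPow (leviRestrict α) n x : G) = autPow α n x := by
  have hnat : ∀ (n : ℕ) (x : leviFactor α),
      (autPow (leviRestrict α) n x : G) = autPow α n x := by
    intro n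
    induction n with
    | zero => intro x; simp [autPow_zero]
    | succ k ih =>
      intro x
      push_cast
      rw [autPow_add_one, autPow_add_one, ih]
      rfl
  obtain ⟨k, rfl | rfl⟩ := n.eq_nat_or_neg
  · exact hnat k x
  · have h := hnat k (autPow (leviRestrict α) (-(k : ℤ)) x)
    rw [autPow_autPow_neg] at h
    rw [h, autPow_neg_autPow]

/-- If `α` is tidy on its Levi factor `M`, there are compact open subgroups `O` such that `O ∩ M`
is invariant and arbitrarily small. -/
theorem exists_subgroup_inter_leviFactor [LocallyCompactSpace G] [TotallyDisconnectedSpace G]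
    {α : G ≃ₜ* G} (hα : IsTidyAut (leviRestrict α)) {U : Set G} (hU : U ∈ 𝓝 1) :
    ∃ O : Subgroup G, IsOpen (O : Set G) ∧ IsCompact (O : Set G) ∧
      IsClosed ((O ⊓ leviFactor α : Subgroup G) : Set G) ∧
      (∀ x ∈ O, x ∈ leviFactor α → x ∈ U) ∧
      ∀ x ∈ O, x ∈ leviFactor α → ∀ k : ℤ, autPow α k x ∈ O := by
  obtain ⟨V, hV, hVU⟩ := hα _ (continuous_subtype_val.continuousAt.preimage_mem_nhds
    (show U ∈ 𝓝 ((1 : leviFactor α) : G) from hU))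
  let M := leviFactor α
  have : LocallyCompactSpace M := hV.isCompact.locallyCompactSpace_of_mem_nhds_of_group
    (hV.isOpen.mem_nhds (x := 1) (one_mem V))
  let W : Subgroup G := V.map M.subtype
  have hWc : IsCompact (W : Set G) := hV.isCompact.image continuous_subtype_val
  obtain ⟨N, hNo, hNV⟩ := isOpen_induced_iff.1 hV.isOpen
  have hWM : W ≤ M := by
    rintro _ ⟨y, -, rfl⟩
    exact y.2
  have hM : IsClosed (M : Set G) := by
    -- Near the identity `M` coincides with the compact group `W`.
    refine isClosed_of_inter_subset M hNo ?_ hWc.isClosed ?_ hWM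
    · have : (1 : M) ∈ Subtype.val ⁻¹' N := hNV ▸ one_mem V
      exact this
    · rintro x ⟨hxM, hxN⟩
      have : (⟨x, hxM⟩ : M) ∈ (V : Set M) := hNV ▸ hxN
      exact ⟨_, this, rfl⟩
  have horb : ∀ x : M,
      IsCompact (closure (Set.range fun n : ℤ => autPow (leviRestrict α) n x)) := by
    intro x
    refine (hM.isClosedEmbedding_subtypeVal.isCompact_preimage x.2).closure_of_subset ?_
    rintro _ ⟨n, rfl⟩
    exact subset_closure ⟨n, (coe_autPow_leviRestrict α n x).symm⟩
  -- Adding the complement of `M` to `N` still forces `O ∩ M ⊆ M ∩ N = W`.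
  obtain ⟨O, hOo, hOc, hWO, hOA⟩ := exists_compact_open_subgroup hWc (hNo.union hM.isOpen_compl)
    (fun x hx => by
      obtain ⟨y, hy, rfl⟩ := hx
      left
      have : y ∈ Subtype.val ⁻¹' N := hNV ▸ hy
      exact this)
  have hOM : ∀ x ∈ O, ∀ hx : x ∈ M, (⟨x, hx⟩ : M) ∈ V := by
    intro x hxO hxM
    rcases hOA hxO with h | h
    · have : (⟨x, hxM⟩ : M) ∈ (Subtype.val ⁻¹' N : Set M) := h
      rwa [hNV] at this
    · exact absurd hxM h
  refine ⟨O, hOo, hOc, hOc.isClosed.inter hM, fun x hxO hxM => hVU (hOM x hxO hxM),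
    fun x hxO hxM k => hWO ⟨_, hV.autPow_mem horb (hOM x hxO hxM) k, ?_⟩⟩
  exact coe_autPow_leviRestrict α k _

/-! ### Factorization `V = V₊ V₋` and closedness of `V₋₋`. -/

theorem isCompact_iteratedInter (α : G ≃ₜ* G) {O : Subgroup G} (hO : IsOpen (O : Set G))
    (hOc : IsCompact (O : Set G)) (N : ℕ) : IsCompact (iteratedInter α O N : Set G) :=
  hOc.of_isClosed_subset (Subgroup.isClosed_of_isOpen _ (isOpen_iteratedInter α hO N))
    (iteratedInter_le α O N)

/-- For large `N`, the compact open subgroup `V = ⋂_{0 ≤ k ≤ N} α ^ k (O)` satisfies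
`V = V₊ V₋`. -/
theorem exists_iteratedInter_factorization [T2Space G] (α : G ≃ₜ* G) {O : Subgroup G}
    (hO : IsOpen (O : Set G)) (hOc : IsCompact (O : Set G)) :
    ∃ N : ℕ, ∀ u ∈ iteratedInter α O N, ∃ a b : G, u = a * b ∧
      (∀ n : ℕ, autPow α (-(n : ℤ)) a ∈ iteratedInter α O N) ∧
      ∀ n : ℕ, autPow α n b ∈ iteratedInter α O N := by
  set P : Set G := {a | ∀ n : ℕ, autPow α (-(n : ℤ)) a ∈ O} with hP
  have hPc : IsClosed P := by
    have := isClosed_setOf_forall_autPow_mem α.symm hOc.isClosed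
    simpa only [autPow_symm] using this
  have hPmul : ∀ a ∈ P, ∀ b ∈ P, a * b ∈ P := fun a ha b hb n => by
    rw [map_mul]; exact mul_mem (ha n) (hb n)
  have hPshift : ∀ a ∈ P, ∀ n : ℕ, autPow α (-(n : ℤ)) a ∈ P := fun a ha n m => by
    rw [← autPow_add]
    have := ha (m + n)
    convert this using 2
    push_cast
    ring_nf
  have hPle : ∀ N, ∀ a ∈ P, a ∈ iteratedInter α O N := fun N a ha =>
    mem_iteratedInter.2 fun k _ => ha k
  set D : Set G := (O : Set G) ∩ autPow α 1 ⁻¹' (O : Set G)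
  have hDo : IsOpen D := hO.inter (hO.preimage (continuous_autPow α 1))
  -- The compact groups `iteratedInter α O N` decrease to `P`, which lies in the open set `P * D`.
  obtain ⟨N, hN⟩ : ∃ N, (iteratedInter α O N : Set G) ⊆ P * D := by
    refine exists_subset_nhds_of_isCompact (V := fun N => (iteratedInter α O N : Set G))
      (Antitone.directed_ge fun a b hab x hx => ?_)
      (isCompact_iteratedInter α hO hOc) fun x hx => ?_
    · exact mem_iteratedInter.2 fun k hk => mem_iteratedInter.1 hx k (hk.trans hab)
    · refine (hDo.mul_left).mem_nhds ⟨x, fun n => ?_, 1, ⟨one_mem O, ?_⟩, mul_one x⟩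
      · exact mem_iteratedInter.1 (Set.mem_iInter.1 hx n) n le_rfl
      · simp [one_mem]
  refine ⟨N, fun u hu => ?_⟩
  set V := iteratedInter α O N
  have hVc : IsClosed (V : Set G) := (isCompact_iteratedInter α hO hOc N).isClosed
  -- To gain one more step, split `α ^ n (b) = a' b'` in `P * D`, move `α ^ (-n) (a')` into the
  -- `P`-factor and keep `α ^ (-n) (b')`.
  have step : ∀ n : ℕ, ∃ b : G, u * b⁻¹ ∈ P ∧ ∀ k : ℕ, k ≤ n → autPow α k b ∈ V := by
    intro n
    induction n with
    | zero =>
      refine ⟨u, by simp [hP, one_mem], fun k hk => ?_⟩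
      obtain rfl : k = 0 := by omega
      simpa [autPow_zero] using hu
    | succ n ih =>
      obtain ⟨b, hb, hbV⟩ := ih
      obtain ⟨a', ha', b', ⟨hb'O, hb'D⟩, hab⟩ := hN (hbV n le_rfl)
      have hab : a' * b' = autPow α n b := hab
      have hb'V : b' ∈ V := by
        have : b' = a'⁻¹ * autPow α n b := by rw [← hab]; group
        rw [this]
        exact mul_mem (inv_mem (hPle N a' ha')) (hbV n le_rfl)
      have hbdec : b = autPow α (-(n : ℤ)) a' * autPow α (-(n : ℤ)) b' := by
        rw [← map_mul, hab, autPow_neg_autPow]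
      refine ⟨autPow α (-(n : ℤ)) b', ?_, fun k hk => ?_⟩
      · have : u * (autPow α (-(n : ℤ)) b')⁻¹ = (u * b⁻¹) * autPow α (-(n : ℤ)) a' := by
          rw [hbdec]; group
        rw [this]
        exact hPmul _ hb _ (hPshift a' ha' n)
      · rcases Nat.lt_or_ge n k with h | h
        · obtain rfl : k = n + 1 := by omega
          have e : autPow α ((n + 1 : ℕ) : ℤ) (autPow α (-(n : ℤ)) b') = autPow α 1 b' := by
            rw [← autPow_add]; congr 2; push_cast; ring
          rw [e]
          refine mem_iteratedInter.2 fun j hj => ?_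
          -- Only `j = 0` is new, and the definition of `D` supplies it; the other indices come from
          -- `b' ∈ V`.
          rcases j with _ | j
          · simpa [autPow_zero] using hb'D
          · rw [← autPow_add]
            have := mem_iteratedInter.1 hb'V j (by omega)
            convert this using 3
            push_cast; ring
        · have e : autPow α (-(n : ℤ)) b' = (autPow α (-(n : ℤ)) a')⁻¹ * b := by
            rw [hbdec]; group
          rw [e, map_mul, map_inv, ← autPow_add]
          refine mul_mem (inv_mem ?_) (hbV k h)
          have := hPle N _ (hPshift a' ha' (n - k))
          convert this using 3
          push_cast [h]; ring
  have hcl : ∀ n : ℕ, IsClosed {b : G | u * b⁻¹ ∈ P ∧ ∀ k : ℕ, k ≤ n → autPow α k b ∈ V} := by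
    intro n
    have h1 : IsClosed {b : G | u * b⁻¹ ∈ P} := hPc.preimage (by fun_prop)
    have h2 : {b : G | u * b⁻¹ ∈ P ∧ ∀ k : ℕ, k ≤ n → autPow α k b ∈ V} =
        {b : G | u * b⁻¹ ∈ P} ∩ ⋂ k : ℕ, ⋂ _ : k ≤ n, autPow α k ⁻¹' (V : Set G) := by
      ext; simp
    rw [h2]
    exact h1.inter (isClosed_iInter fun k => isClosed_iInter fun _ =>
      hVc.preimage (continuous_autPow α k))
  -- By compactness one `b` works for all `n`.
  obtain ⟨b, hb⟩ := IsCompact.nonempty_iInter_of_sequence_nonempty_isCompact_isClosed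
    (fun n : ℕ => {b : G | u * b⁻¹ ∈ P ∧ ∀ k : ℕ, k ≤ n → autPow α k b ∈ V})
    (fun n b hb => ⟨hb.1, fun k hk => hb.2 k (by omega)⟩) step
    (hOc.of_isClosed_subset (hcl 0) fun b hb => iteratedInter_le α O N
      (by simpa [autPow_zero] using hb.2 0 le_rfl)) hcl
  have hb' := fun n => Set.mem_iInter.1 hb n
  exact ⟨u * b⁻¹, b, by group, fun n => hPle N _ (hPshift _ (hb' 0).1 n),
    fun n => (hb' n).2 n le_rfl⟩

/-- Closedness need only be checked inside `V`. If `x = a b` there is eventually in `V`, then so is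
`a`; its backward orbit stays in `V` too, so `a ∈ M`. Invariance keeps the orbit of `a` in `V`,
hence `x ∈ V₋`, which is closed. -/
theorem isClosed_eventuallyIn [T2Space G] {α : G ≃ₜ* G} {V : Subgroup G} (hV : IsOpen (V : Set G))
    (hVc : IsCompact (V : Set G))
    (hfac : ∀ u ∈ V, ∃ a b : G, u = a * b ∧ (∀ n : ℕ, autPow α (-(n : ℤ)) a ∈ V) ∧
      ∀ n : ℕ, autPow α n b ∈ V)
    (hM : ∀ x ∈ V, x ∈ leviFactor α → ∀ k : ℤ, autPow α k x ∈ V) :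
    IsClosed (eventuallyIn α V : Set G) := by
  refine isClosed_of_inter_subset _ hV (one_mem V) (isClosed_setOf_forall_autPow_mem α hVc.isClosed) ?_
    fun x hx => Eventually.of_forall hx
  rintro x ⟨hx, hxV⟩ n
  obtain ⟨a, b, rfl, ha, hb⟩ := hfac x hxV
  have haM : a ∈ leviFactor α := by
    refine mem_leviFactor_of_eventually hVc ?_ (Eventually.of_forall ha)
    filter_upwards [hx] with m hm
    have := mul_mem hm (inv_mem (hb m))
    simpa using this
  have haV : a ∈ V := by simpa [autPow_zero] using ha 0
  rw [map_mul]
  exact mul_mem (hM a haV haM n) (hb n)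

theorem contractionGroup_le_eventuallyIn (α : G ≃ₜ* G) {V : Subgroup G}
    (hV : IsOpen (V : Set G)) : contractionGroup α ≤ eventuallyIn α V :=
  fun _ hx => hx (hV.mem_nhds (one_mem V))

end TopologicalGroup

/-! ### Triviality of `K` and `U₀`. -/

theorem lemma2 {G : Type*} [Group G] [TopologicalSpace G] [IsTopologicalGroup G]
    [LocallyCompactSpace G] [TotallyDisconnectedSpace G] (α : G ≃ₜ* G)
    (hα : IsTidyAut (leviRestrict α)) :
    tidyingK α = ⊥ ∧ contractionU0 α = ⊥ := by
  constructor
  · refine (Subgroup.eq_bot_iff_forall _).2 fun x hx => ?_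
    by_contra hx1
    obtain ⟨O, hO, hOc, hcl, hU, hinv⟩ := exists_subgroup_inter_leviFactor hα
      (isOpen_compl_singleton.mem_nhds (Ne.symm hx1) : ({x}ᶜ : Set G) ∈ 𝓝 1)
    have hle : eventualSubgroup α O ≤ O ⊓ leviFactor α := by
      rintro y ⟨hyM, hy⟩
      obtain ⟨n, hn⟩ := hy.exists
      refine ⟨?_, hyM⟩
      have := hinv _ hn (autPow_mem_leviFactor hyM n) (-(n : ℤ))
      rwa [autPow_neg_autPow] at this
    have hxO : x ∈ (eventualSubgroup α O).topologicalClosure := by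
      simp only [tidyingK, Subgroup.mem_iInf] at hx
      exact hx O hOc hO
    have hxO := Subgroup.topologicalClosure_minimal _ hle hcl hxO
    exact hU x hxO.1 hxO.2 rfl
  · refine (Subgroup.eq_bot_iff_forall _).2 fun x hx => ?_
    by_contra hx1
    obtain ⟨O, hO, hOc, -, hU, hinv⟩ := exists_subgroup_inter_leviFactor hα
      (isOpen_compl_singleton.mem_nhds (Ne.symm hx1) : ({x}ᶜ : Set G) ∈ 𝓝 1)
    obtain ⟨N, hN⟩ := exists_iteratedInter_factorization α hO hOc
    have hVo := isOpen_iteratedInter α hO N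
    have hVc := isCompact_iteratedInter α hO hOc N
    have hVO := iteratedInter_le α O N
    have hM : ∀ y ∈ iteratedInter α O N, y ∈ leviFactor α →
        ∀ k : ℤ, autPow α k y ∈ iteratedInter α O N := fun y hy hyM k =>
      mem_iteratedInter.2 fun j _ => by
        rw [← autPow_add]
        exact hinv y (hVO hy) hyM _
    have h1 := Subgroup.topologicalClosure_minimal _ (contractionGroup_le_eventuallyIn α hVo)
      (isClosed_eventuallyIn hVo hVc hN hM) hx.1
    have h2 := Subgroup.topologicalClosure_minimal _
      (contractionGroup_le_eventuallyIn α.symm hVo)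
      (isClosed_eventuallyIn hVo hVc
        (fun u hu => by
          -- Passing to `α⁻¹` swaps the roles of `V₊` and `V₋`; factoring `u⁻¹` restores the order
          -- of the product.
          obtain ⟨a, b, hab, ha, hb⟩ := hN u⁻¹ (inv_mem hu)
          refine ⟨b⁻¹, a⁻¹, by rw [← mul_inv_rev, ← hab, inv_inv], fun n => ?_, fun n => ?_⟩
          · rw [autPow_symm, neg_neg, map_inv]
            exact inv_mem (hb n)
          · rw [autPow_symm, map_inv]
            exact inv_mem (ha n))
        fun y hy hyM k => by
          rw [autPow_symm]
          exact hM y hy ((mem_leviFactor_symm α y).1 hyM) _) hx.2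
    simp only [mem_eventuallyIn, autPow_symm] at h1 h2
    have hxM : x ∈ leviFactor α := mem_leviFactor_of_eventually hVc h1 h2
    -- Since `x ∈ M`, one visit of its orbit to `V ⊆ O` suffices: invariance of `O ∩ M` carries it
    -- back to time `0`.
    obtain ⟨n, hn⟩ := h1.exists
    have hxO := hinv _ (hVO hn) (autPow_mem_leviFactor hxM n) (-(n : ℤ))
    rw [autPow_neg_autPow] at hxO
    exact hU x hxO hxM rfl
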